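/- A two-player zero-sum partially observable stochastic game is given by finite sets $\mathcal S$ (states), $\mathcal A^1,\mathcal A^2$ (non-empty sets of actions) and $\mathcal Z^1,\mathcal Z^2$ (observations), probabilities $P^{z^1,z^2}_{a^1,a^2}(s'\mid s)$ of moving to $s'$ and emitting $z^1,z^2$ when $a^1,a^2$ are performed in $s$, a reward function $r(s,a^1,a^2)\in\mathbb R$ (Player 1 maximizes, Player 2 minimizes), a finite horizon $H\in\mathbb N$, a discount factor $\gamma\in[0,1]$ and an initial belief $b_0$ on $\mathcal S$. A history of player $i$ at time $\tau$ is $\theta^i_\tau=(a^i_1,z^i_1,\dots,a^i_\tau,z^i_\tau)$. A decision rule $\beta^i_\tau$ of player $i$ at time $\tau$ assigns to each history $\theta^i_\tau$ a probability distribution $\beta^i_\tau(\theta^i_\tau,\cdot)$ on $\mathcal A^i$; a (behavioral) strategy $\beta^i_{\tau:}$ consists of one decision rule for each time $\tau,\dots,H-1$. Let $b(\cdot\mid\theta^1_\tau,\theta^2_\tau)$ be the belief on states obtained from $b_0$ by filtering along the joint history. An occupancy state $\sigma_\tau$ is a distribution of the joint history $(\theta^1_\tau,\theta^2_\tau)$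 that is induced by some pair of strategies. For an occupancy state $\sigma_\tau$ and decision rules $\beta^1_\tau,\beta^2_\tau$ let $$T(\sigma_\tau,\beta^1_\tau,\beta^2_\tau)\big((\theta^1,a^1,z^1),(\theta^2,a^2,z^2)\big)=\beta^1_\tau(\theta^1,a^1)\,\beta^2_\tau(\theta^2,a^2)\,\sigma_\tau(\theta^1,\theta^2)\sum_{s,s'}P^{z^1,z^2}_{a^1,a^2}(s'\mid s)\,b(s\mid\theta^1,\theta^2)$$ be the next occupancy state, and let $$r(\sigma_\tau,\beta^1_\tau,\beta^2_\tau)=\sum_{s,\theta^1,\theta^2,a^1,a^2}\sigma_\tau(\theta^1,\theta^2)\,b(s\mid\theta^1,\theta^2)\,\beta^1_\tau(\theta^1,a^1)\,\beta^2_\tau(\theta^2,a^2)\,r(s,a^1,a^2).$$ Let $V_\tau(\sigma_\tau,\beta^1_{\tau:},\beta^2_{\tau:})=\mathbb E\big[\sum_{t=\tau}^{H-1}\gamma^{t-\tau}R_t\mid\sigma_\tau,\beta^1_{\tau:},\beta^2_{\tau:}\big]$, where $R_t$ is the reward at time $t$, let $V^*_\tau(\sigma_\tau)=\max_{\beta^1_{\tau:}}\min_{\beta^2_{\tau:}}V_\tau(\sigma_\tau,\beta^1_{\tau:},\beta^2_{\tau:})$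 (so $V^*_H=0$), and for $0\le\tau\le H-1$ let $$Q^*_\tau(\sigma_\tau,\beta^1_\tau,\beta^2_\tau)=r(\sigma_\tau,\beta^1_\tau,\beta^2_\tau)+\gamma\,V^*_{\tau+1}\big(T(\sigma_\tau,\beta^1_\tau,\beta^2_\tau)\big).$$ **Lemma.** Let $0\le\tau\le H-1$ and let $\sigma_\tau$ be an occupancy state at time $\tau$. Then $Q^*_\tau(\sigma_\tau,\beta^1_\tau,\beta^2_\tau)$ is concave in $\beta^1_\tau$ for each fixed $\beta^2_\tau$, and convex in $\beta^2_\tau$ for each fixed $\beta^1_\tau$. Moreover the minimax theorem holds for the local game with payoff $Q^*_\tau(\sigma_\tau,\cdot,\cdot)$, where $\beta^1_\tau$ and $\beta^2_\tau$ range over the decision rules at time $\tau$: $$\max_{\beta^1_\tau}\min_{\beta^2_\tau}Q^*_\tau(\sigma_\tau,\beta^1_\tau,\beta^2_\tau)=\min_{\beta^2_\tau}\max_{\beta^1_\tau}Q^*_\tau(\sigma_\tau,\beta^1_\tau,\beta^2_\tau),$$ with all the maxima and minima in this equality attained. -/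

import Mathlib

/-- A finite two-player zero-sum partially observable stochastic game with finite horizon `H`,
discount factor `γ ∈ [0, 1]` and initial belief `b₀`.
`P s a₁ a₂ s' z₁ z₂` is the probability to move to state `s'` and to emit the observations
`z₁, z₂` when the actions `a₁, a₂` are performed in state `s`. -/
structure ZsPOSG (S A₁ A₂ Z₁ Z₂ : Type*) [Fintype S] [Fintype Z₁] [Fintype Z₂] where
  P : S → A₁ → A₂ → S → Z₁ → Z₂ → ℝ
  P_nonneg : ∀ s a₁ a₂ s' z₁ z₂, 0 ≤ P s a₁ a₂ s' z₁ z₂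
  P_sum : ∀ s a₁ a₂, ∑ s', ∑ z₁, ∑ z₂, P s a₁ a₂ s' z₁ z₂ = 1
  r : S → A₁ → A₂ → ℝ
  H : ℕ
  γ : ℝ
  γ_nonneg : 0 ≤ γ
  γ_le_one : γ ≤ 1
  b₀ : S → ℝ
  b₀_mem : b₀ ∈ stdSimplex ℝ S

/-- Action-observation histories `(a₁, z₁, …, a_t, z_t)` of length `t` of one player. The history
`(θ, a, z)` of length `t + 1` is the tuple `θ'` with `Fin.init θ' = θ` and
`θ' (Fin.last t) = (a, z)`. -/
abbrev AOHist (A Z : Type*) (t : ℕ) : Type _ := Fin t → A × Z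

/-- Behavioral decision rules at time `t`: maps from private histories of length `t` to
probability distributions over private actions. `β θ a` is the probability to pick `a` at `θ`. -/
def decisionRules (A Z : Type*) [Fintype A] (t : ℕ) : Set (AOHist A Z t → A → ℝ) :=
  {β | ∀ θ, β θ ∈ stdSimplex ℝ A}

/-- Behavioral strategies: one decision rule per time step. The value `V_τ` of the subgame at
time `τ` below only reads the components at times `τ, …, H - 1`. -/
def Strategy (A Z : Type*) [Fintype A] : Type _ :=
  {β : (t : ℕ) → AOHist A Z t → A → ℝ // ∀ t, β t ∈ decisionRules A Z t}

namespace ZsPOSG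

variable {S A₁ A₂ Z₁ Z₂ : Type*} [Fintype S] [Fintype A₁] [Fintype A₂] [Fintype Z₁] [Fintype Z₂]

/-- One step of the game: from the weights `w θ₁ θ₂ s` of (joint history, state) at time `t` to
those at time `t + 1`, under the decision rules `β₁, β₂` at time `t`. -/
def step (G : ZsPOSG S A₁ A₂ Z₁ Z₂) {t : ℕ}
    (w : AOHist A₁ Z₁ t → AOHist A₂ Z₂ t → S → ℝ)
    (β₁ : AOHist A₁ Z₁ t → A₁ → ℝ) (β₂ : AOHist A₂ Z₂ t → A₂ → ℝ)
    (θ₁ : AOHist A₁ Z₁ (t + 1)) (θ₂ : AOHist A₂ Z₂ (t + 1)) (s' : S) : ℝ :=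
  ∑ s, w (Fin.init θ₁) (Fin.init θ₂) s
    * β₁ (Fin.init θ₁) (θ₁ (Fin.last t)).1 * β₂ (Fin.init θ₂) (θ₂ (Fin.last t)).1
    * G.P s (θ₁ (Fin.last t)).1 (θ₂ (Fin.last t)).1 s' (θ₁ (Fin.last t)).2 (θ₂ (Fin.last t)).2

/-- Joint law of (joint history, state) at time `t` when the game starts from `b₀` and the
strategy profile `(β₁, β₂)` is played. -/
def initialLaw (G : ZsPOSG S A₁ A₂ Z₁ Z₂) (β₁ : Strategy A₁ Z₁) (β₂ : Strategy A₂ Z₂) :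
    (t : ℕ) → AOHist A₁ Z₁ t → AOHist A₂ Z₂ t → S → ℝ
  | 0 => fun _ _ s => G.b₀ s
  | t + 1 => G.step (initialLaw G β₁ β₂ t) (β₁.1 t) (β₂.1 t)

/-- The occupancy states at time `t`: the distributions of the joint history at time `t` induced
by the strategy profiles. -/
def occupancyStates (G : ZsPOSG S A₁ A₂ Z₁ Z₂) (t : ℕ) :
    Set (AOHist A₁ Z₁ t → AOHist A₂ Z₂ t → ℝ) :=
  {σ | ∃ (β₁ : Strategy A₁ Z₁) (β₂ : Strategy A₂ Z₂),
    ∀ θ₁ θ₂, σ θ₁ θ₂ = ∑ s, G.initialLaw β₁ β₂ t θ₁ θ₂ s}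

/-- The belief `b(s | θ₁, θ₂)` obtained by HMM filtering. It depends on the model only. On joint
histories that are impossible under every strategy profile it takes the junk value `0`; such
histories have probability `0` in every occupancy state. -/
noncomputable def belief (G : ZsPOSG S A₁ A₂ Z₁ Z₂) :
    (t : ℕ) → AOHist A₁ Z₁ t → AOHist A₂ Z₂ t → S → ℝ
  | 0 => fun _ _ s => G.b₀ s
  | t + 1 => fun θ₁ θ₂ s' =>
      (∑ s, belief G t (Fin.init θ₁) (Fin.init θ₂) s
        * G.P s (θ₁ (Fin.last t)).1 (θ₂ (Fin.last t)).1 s'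
            (θ₁ (Fin.last t)).2 (θ₂ (Fin.last t)).2)
      / ∑ s'', ∑ s, belief G t (Fin.init θ₁) (Fin.init θ₂) s
        * G.P s (θ₁ (Fin.last t)).1 (θ₂ (Fin.last t)).1 s''
            (θ₁ (Fin.last t)).2 (θ₂ (Fin.last t)).2

/-- The transition function `T(σ, β)` of the occupancy game. -/
noncomputable def T (G : ZsPOSG S A₁ A₂ Z₁ Z₂) {t : ℕ}
    (σ : AOHist A₁ Z₁ t → AOHist A₂ Z₂ t → ℝ)
    (β₁ : AOHist A₁ Z₁ t → A₁ → ℝ) (β₂ : AOHist A₂ Z₂ t → A₂ → ℝ)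
    (θ₁ : AOHist A₁ Z₁ (t + 1)) (θ₂ : AOHist A₂ Z₂ (t + 1)) : ℝ :=
  β₁ (Fin.init θ₁) (θ₁ (Fin.last t)).1 * β₂ (Fin.init θ₂) (θ₂ (Fin.last t)).1
    * σ (Fin.init θ₁) (Fin.init θ₂)
    * ∑ s, ∑ s', G.P s (θ₁ (Fin.last t)).1 (θ₂ (Fin.last t)).1 s'
          (θ₁ (Fin.last t)).2 (θ₂ (Fin.last t)).2
        * G.belief t (Fin.init θ₁) (Fin.init θ₂) s

/-- The expected reward `r(σ, β)` of the occupancy game. -/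
noncomputable def reward (G : ZsPOSG S A₁ A₂ Z₁ Z₂) {t : ℕ}
    (σ : AOHist A₁ Z₁ t → AOHist A₂ Z₂ t → ℝ)
    (β₁ : AOHist A₁ Z₁ t → A₁ → ℝ) (β₂ : AOHist A₂ Z₂ t → A₂ → ℝ) : ℝ :=
  ∑ s, ∑ θ₁, ∑ θ₂, ∑ a₁, ∑ a₂,
    σ θ₁ θ₂ * G.belief t θ₁ θ₂ s * β₁ θ₁ a₁ * β₂ θ₂ a₂ * G.r s a₁ a₂

/-- Joint law of (joint history, state) at time `τ + k` in the subgame at `σ`: at time `τ` the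
joint history is drawn from `σ` and the state from the belief, then `(β₁, β₂)` is played. -/
noncomputable def subgameLaw (G : ZsPOSG S A₁ A₂ Z₁ Z₂) (τ : ℕ)
    (σ : AOHist A₁ Z₁ τ → AOHist A₂ Z₂ τ → ℝ) (β₁ : Strategy A₁ Z₁) (β₂ : Strategy A₂ Z₂) :
    (k : ℕ) → AOHist A₁ Z₁ (τ + k) → AOHist A₂ Z₂ (τ + k) → S → ℝ
  | 0 => fun θ₁ θ₂ s => σ θ₁ θ₂ * G.belief τ θ₁ θ₂ s
  | k + 1 => G.step (subgameLaw G τ σ β₁ β₂ k) (β₁.1 (τ + k)) (β₂.1 (τ + k))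

/-- The value `V_τ(σ, β₁, β₂) = E[∑_{t=τ}^{H-1} γ^(t-τ) R_t | σ, β₁, β₂]` of the subgame at `σ`. -/
noncomputable def V (G : ZsPOSG S A₁ A₂ Z₁ Z₂) (τ : ℕ)
    (σ : AOHist A₁ Z₁ τ → AOHist A₂ Z₂ τ → ℝ)
    (β₁ : Strategy A₁ Z₁) (β₂ : Strategy A₂ Z₂) : ℝ :=
  ∑ k ∈ Finset.range (G.H - τ), G.γ ^ k *
    ∑ s, ∑ θ₁, ∑ θ₂, ∑ a₁, ∑ a₂,
      G.subgameLaw τ σ β₁ β₂ k θ₁ θ₂ s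
        * β₁.1 (τ + k) θ₁ a₁ * β₂.1 (τ + k) θ₂ a₂ * G.r s a₁ a₂

/-- The optimal value `V*_τ(σ) = max_{β₁} min_{β₂} V_τ(σ, β₁, β₂)`.
For every `σ`, `V_τ(σ, ·, ·)` is bounded, so that the supremum and the
infimum are genuine. -/
noncomputable def Vstar (G : ZsPOSG S A₁ A₂ Z₁ Z₂) (τ : ℕ)
    (σ : AOHist A₁ Z₁ τ → AOHist A₂ Z₂ τ → ℝ) : ℝ :=
  ⨆ β₁ : Strategy A₁ Z₁, ⨅ β₂ : Strategy A₂ Z₂, G.V τ σ β₁ β₂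

/-- The payoff `Q*_τ(σ, β₁, β₂) = r(σ, β) + γ V*_{τ+1}(T(σ, β))` of the local game at `σ`. -/
noncomputable def Qstar (G : ZsPOSG S A₁ A₂ Z₁ Z₂) (τ : ℕ)
    (σ : AOHist A₁ Z₁ τ → AOHist A₂ Z₂ τ → ℝ)
    (β₁ : AOHist A₁ Z₁ τ → A₁ → ℝ) (β₂ : AOHist A₂ Z₂ τ → A₂ → ℝ) : ℝ :=
  G.reward σ β₁ β₂ + G.γ * G.Vstar (τ + 1) (G.T σ β₁ β₂)

/-- `W^{1,*}_τ(σ, β₁) = min_{β₂} Q*_τ(σ, β₁, β₂)`. -/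
noncomputable def W₁star (G : ZsPOSG S A₁ A₂ Z₁ Z₂) (τ : ℕ)
    (σ : AOHist A₁ Z₁ τ → AOHist A₂ Z₂ τ → ℝ) (β₁ : AOHist A₁ Z₁ τ → A₁ → ℝ) : ℝ :=
  ⨅ β₂ : decisionRules A₂ Z₂ τ, G.Qstar τ σ β₁ β₂.1

/-- `W^{2,*}_τ(σ, β₂) = max_{β₁} Q*_τ(σ, β₁, β₂)`. -/
noncomputable def W₂star (G : ZsPOSG S A₁ A₂ Z₁ Z₂) (τ : ℕ)
    (σ : AOHist A₁ Z₁ τ → AOHist A₂ Z₂ τ → ℝ) (β₂ : AOHist A₂ Z₂ τ → A₂ → ℝ) : ℝ :=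
  ⨆ β₁ : decisionRules A₁ Z₁ τ, G.Qstar τ σ β₁.1 β₂

end ZsPOSG

/-! The next occupancy state factors as `β₁ * β₂ * chance`, where the chance factor depends on `σ`
and the model only. The subgame value after one step is not linear in the behavioral strategies, but
it is bilinear in the realization plans, in which each player's own action probabilities, starting
with those of the current rule, are multiplied together (`V_T_eq_planPayoff`).

The plans extending `β₁` form a compact convex set cut out by the sequence-form constraints, and
each of its points comes from a behavioral strategy (`exists_realizationPlan_eq`). By Sion's
theorem, `V*` at the next occupancy state is thus the value of a bilinear game on two such sets. The
constraints are linear in the pair (rule, plan), so a mixture of plans extending `β` and `β'`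
extends the same mixture of rules (`realizationPlans_combo`). Mixing optimal plans gives concavity
for Player 1 and convexity for Player 2; the bilinear reward preserves both.

`Q*` is also continuous, as a sup-inf over fixed compact strategy spaces plus a polynomial, so a
second use of Sion's theorem, on the decision rules, gives the minimax equality with all optima
attained. -/

open Set Topology

/-! ### Two-player zero-sum games on compact convex sets -/

section Minimax

variable {E F : Type*} [TopologicalSpace E] [AddCommGroup E] [Module ℝ E]
  [IsTopologicalAddGroup E] [ContinuousSMul ℝ E] [TopologicalSpace F] [AddCommGroup F] [Module ℝ F]
  [IsTopologicalAddGroup F] [ContinuousSMul ℝ F]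

/-- A continuous concave-convex payoff on nonempty compact convex sets has a saddle point. -/
theorem exists_saddlePoint_of_concave_convex {f : E → F → ℝ} {X : Set E} {Y : Set F}
    (hX : IsCompact X) (hX₀ : X.Nonempty) (hXc : Convex ℝ X)
    (hY : IsCompact Y) (hY₀ : Y.Nonempty) (hYc : Convex ℝ Y)
    (hf : Continuous fun p : E × F => f p.1 p.2)
    (hfX : ∀ y ∈ Y, ConcaveOn ℝ X fun x => f x y) (hfY : ∀ x ∈ X, ConvexOn ℝ Y (f x)) :
    ∃ x ∈ X, ∃ y ∈ Y, ∀ x' ∈ X, ∀ y' ∈ Y, f x' y ≤ f x y' := by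
  -- The minimizer comes first in Sion's theorem, so the players swap places.
  obtain ⟨y, hy, x, hx, h⟩ := Sion.exists_isSaddlePointOn (X := Y) (Y := X)
    (f := fun y x => f x y) hY₀ hYc hY
    (fun x _ => (hf.comp (Continuous.prodMk_right x)).lowerSemicontinuous.lowerSemicontinuousOn _)
    (fun x hx => (hfY x hx).quasiconvexOn) hXc hX₀ hX
    (fun y _ => (hf.comp (Continuous.prodMk_left y)).upperSemicontinuous.upperSemicontinuousOn _)
    (fun y hy => (hfX y hy).quasiconcaveOn)
  exact ⟨x, hx, y, hy, fun x' hx' y' hy' => h y' hy' x' hx'⟩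

/-- The minimax theorem with all optima attained. -/
theorem minimax_attained {f : E → F → ℝ} {X : Set E} {Y : Set F}
    (hX : IsCompact X) (hX₀ : X.Nonempty) (hXc : Convex ℝ X)
    (hY : IsCompact Y) (hY₀ : Y.Nonempty) (hYc : Convex ℝ Y)
    (hf : Continuous fun p : E × F => f p.1 p.2)
    (hfX : ∀ y ∈ Y, ConcaveOn ℝ X fun x => f x y) (hfY : ∀ x ∈ X, ConvexOn ℝ Y (f x)) :
    (∀ x, IsLeast (f x '' Y) (⨅ y : Y, f x y)) ∧
    (∀ y, IsGreatest ((fun x => f x y) '' X) (⨆ x : X, f x y)) ∧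
    ∃ v, IsGreatest ((fun x => ⨅ y : Y, f x y) '' X) v ∧
      IsLeast ((fun y => ⨆ x : X, f x y) '' Y) v := by
  have hl : ∀ x, IsLeast (f x '' Y) (⨅ y : Y, f x y) := fun x => by
    rw [← sInf_image']
    exact (hY.image (hf.comp (Continuous.prodMk_right x))).isLeast_sInf (hY₀.image _)
  have hg : ∀ y, IsGreatest ((fun x => f x y) '' X) (⨆ x : X, f x y) := fun y => by
    rw [← sSup_image' (f := fun x => f x y)]
    exact (hX.image (hf.comp (Continuous.prodMk_left y))).isGreatest_sSup (hX₀.image _)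
  obtain ⟨x, hx, y, hy, h⟩ :=
    exists_saddlePoint_of_concave_convex hX hX₀ hXc hY hY₀ hYc hf hfX hfY
  have hxv : ⨅ y : Y, f x y = f x y :=
    le_antisymm ((hl x).2 ⟨y, hy, rfl⟩) ((hl x).isGLB.2 (by
      rintro _ ⟨y', hy', rfl⟩; exact h x hx y' hy'))
  have hyv : ⨆ x : X, f x y = f x y :=
    le_antisymm ((hg y).isLUB.2 (by rintro _ ⟨x', hx', rfl⟩; exact h x' hx' y hy))
      ((hg y).2 ⟨x, hx, rfl⟩)
  refine ⟨hl, hg, f x y, ⟨⟨x, hx, hxv⟩, ?_⟩, ⟨⟨y, hy, hyv⟩, ?_⟩⟩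
  · rintro _ ⟨x', hx', rfl⟩
    exact ((hl x').2 ⟨y, hy, rfl⟩).trans (h x' hx' y hy)
  · rintro _ ⟨y', hy', rfl⟩
    exact (h x hx y' hy').trans ((hg y').2 ⟨x, hx, rfl⟩)

/-- The infimum of a continuous function over a compact space is continuous in the parameter. -/
theorem continuous_iInf_of_compactSpace {X Y : Type*} [TopologicalSpace X] [TopologicalSpace Y]
    [CompactSpace Y] {f : X → Y → ℝ} (hf : Continuous fun p : X × Y => f p.1 p.2) :
    Continuous fun x => ⨅ y, f x y := by
  simpa only [image_univ, sInf_range] using isCompact_univ.continuous_sInf (f := f) hf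

/-- The supremum of a continuous function over a compact space is continuous in the parameter. -/
theorem continuous_iSup_of_compactSpace {X Y : Type*} [TopologicalSpace X] [TopologicalSpace Y]
    [CompactSpace Y] {f : X → Y → ℝ} (hf : Continuous fun p : X × Y => f p.1 p.2) :
    Continuous fun x => ⨆ y, f x y := by
  simpa only [image_univ, sSup_range] using isCompact_univ.continuous_sSup (f := f) hf

end Minimax

/-! ### Decision rules and strategies -/

section Strategies

variable {A Z : Type*} [Fintype A]

theorem decisionRules_eq_pi (t : ℕ) :
    decisionRules A Z t = univ.pi fun _ => stdSimplex ℝ A := by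
  ext β; simp [decisionRules]

theorem isCompact_decisionRules (t : ℕ) : IsCompact (decisionRules A Z t) := by
  rw [decisionRules_eq_pi]
  exact isCompact_univ_pi fun _ => isCompact_stdSimplex _ _

theorem convex_decisionRules (t : ℕ) : Convex ℝ (decisionRules A Z t) := by
  rw [decisionRules_eq_pi]
  exact convex_pi fun _ _ => convex_stdSimplex _ _

theorem decisionRules_nonempty [Nonempty A] (t : ℕ) : (decisionRules A Z t).Nonempty := by
  classical
  exact ⟨fun _ => Pi.single (Classical.arbitrary A) 1, fun _ => single_mem_stdSimplex _ _⟩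

namespace Strategy

instance : TopologicalSpace (Strategy A Z) :=
  inferInstanceAs (TopologicalSpace
    {β : (t : ℕ) → AOHist A Z t → A → ℝ // ∀ t, β t ∈ decisionRules A Z t})

instance : CompactSpace (Strategy A Z) := by
  have h := isCompact_univ_pi fun t => isCompact_decisionRules (A := A) (Z := Z) t
  have h' : IsCompact {β : (t : ℕ) → AOHist A Z t → A → ℝ | ∀ t, β t ∈ decisionRules A Z t} := by
    simpa [Set.pi] using h
  exact isCompact_iff_compactSpace.1 h'

instance [Nonempty A] : Nonempty (Strategy A Z) :=
  ⟨⟨fun t => (decisionRules_nonempty t).some, fun t => (decisionRules_nonempty t).some_mem⟩⟩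

theorem continuous_coe :
    Continuous (Subtype.val : Strategy A Z → (t : ℕ) → AOHist A Z t → A → ℝ) :=
  continuous_subtype_val

@[fun_prop]
theorem continuous_apply {X : Type*} [TopologicalSpace X] {b : X → Strategy A Z}
    (hb : Continuous b) (t : ℕ) (θ : AOHist A Z t) (a : A) :
    Continuous fun x => (b x).1 t θ a := by
  have := continuous_coe.comp hb
  exact (_root_.continuous_apply_apply θ a).comp ((_root_.continuous_apply t).comp this)

end Strategy

/-! ### Realization plans -/

/-- The realization plan of a strategy from time `u` on: the product of the initial weight of a
private history and of the probabilities of the own actions since time `u`. -/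
def realizationPlan {u : ℕ} (m : AOHist A Z u → ℝ) (b : (t : ℕ) → AOHist A Z t → A → ℝ) :
    (k : ℕ) → AOHist A Z (u + k) → A → ℝ
  | 0 => fun θ a => m θ * b u θ a
  | k + 1 => fun θ a =>
      realizationPlan m b k (Fin.init θ) (θ (Fin.last (u + k))).1 * b (u + k + 1) θ a

/-- The sequence-form constraints on realization plans with initial weights `m`. -/
def realizationPlans {u : ℕ} (m : AOHist A Z u → ℝ) :
    Set ((k : ℕ) → AOHist A Z (u + k) → A → ℝ) :=
  {p | (∀ k θ a, 0 ≤ p k θ a) ∧ (∀ θ, ∑ a, p 0 θ a = m θ) ∧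
    ∀ (k : ℕ) (θ : AOHist A Z (u + k + 1)),
      ∑ a, p (k + 1) θ a = p k (Fin.init θ) (θ (Fin.last (u + k))).1}

theorem realizationPlan_mem {u : ℕ} {m : AOHist A Z u → ℝ} (hm : ∀ θ, 0 ≤ m θ)
    (b : Strategy A Z) : realizationPlan m b.1 ∈ realizationPlans m := by
  refine ⟨fun k => ?_, fun θ => ?_, fun k θ => ?_⟩
  · induction k with
    | zero => exact fun θ a => mul_nonneg (hm θ) ((b.2 u θ).1 a)
    | succ k ih => exact fun θ a => mul_nonneg (ih _ _) ((b.2 (u + k + 1) θ).1 a)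
  · simp only [realizationPlan]
    rw [← Finset.mul_sum, (b.2 u θ).2, mul_one]
  · simp only [realizationPlan]
    rw [← Finset.mul_sum, (b.2 (u + k + 1) θ).2, mul_one]

/-- A nonnegative vector is its mass times a probability vector. -/
theorem exists_mem_stdSimplex_eq_mul [Nonempty A] {x : A → ℝ} (hx : ∀ a, 0 ≤ x a) :
    ∃ y ∈ stdSimplex ℝ A, ∀ a, x a = (∑ a', x a') * y a := by
  classical
  by_cases h : ∑ a', x a' = 0
  -- Zero mass: all entries vanish, and any distribution will do.
  · refine ⟨Pi.single (Classical.arbitrary A) 1, single_mem_stdSimplex _ _, fun a => ?_⟩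
    rw [h, zero_mul]
    exact (Finset.sum_eq_zero_iff_of_nonneg fun a _ => hx a).1 h a (Finset.mem_univ a)
  · refine ⟨fun a => x a / ∑ a', x a', ⟨fun a => ?_, ?_⟩, fun a => ?_⟩
    · exact div_nonneg (hx a) (Finset.sum_nonneg fun a _ => hx a)
    · rw [← Finset.sum_div, div_self h]
    · rw [mul_div_cancel₀ _ h]

/-- Every point of the sequence-form polytope is the realization plan of a behavioral strategy. -/
theorem exists_realizationPlan_eq [Nonempty A] {u : ℕ} {m : AOHist A Z u → ℝ}
    {p : (k : ℕ) → AOHist A Z (u + k) → A → ℝ} (hp : p ∈ realizationPlans m) :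
    ∃ b : Strategy A Z, realizationPlan m b.1 = p := by
  -- Strategies are indexed by absolute time `t`, plans by the offset `k` from `u`; hence the
  -- transport along `t = u + k`. At times before `u` the rule is arbitrary.
  have key : ∀ t, ∃ β ∈ decisionRules A Z t, ∀ (k : ℕ) (h : t = u + k) (θ : AOHist A Z t) (a : A),
      p k (h ▸ θ) a = (∑ a', p k (h ▸ θ) a') * β θ a := by
    intro t
    by_cases h : ∃ k, t = u + k
    · obtain ⟨k, rfl⟩ := h
      choose β hβ hβp using fun θ => exists_mem_stdSimplex_eq_mul (hp.1 k θ)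
      refine ⟨β, hβ, fun k' h θ a => ?_⟩
      obtain rfl : k = k' := by omega
      exact hβp θ a
    · exact ⟨_, (decisionRules_nonempty t).some_mem, fun k hk => (h ⟨k, hk⟩).elim⟩
  choose b hb hbp using key
  refine ⟨⟨b, hb⟩, funext fun k => ?_⟩
  induction k with
  | zero =>
    funext θ a
    have h := hbp (u + 0) 0 rfl θ a
    simp only [realizationPlan]
    rw [← hp.2.1 θ]
    exact h.symm
  | succ k ih =>
    funext θ a
    have h := hbp (u + k + 1) (k + 1) rfl θ a
    simp only [realizationPlan]
    rw [ih, ← hp.2.2 k θ]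
    exact h.symm

theorem range_realizationPlan [Nonempty A] {u : ℕ} {m : AOHist A Z u → ℝ} (hm : ∀ θ, 0 ≤ m θ) :
    range (fun b : Strategy A Z => realizationPlan m b.1) = realizationPlans m :=
  Subset.antisymm (by rintro _ ⟨b, rfl⟩; exact realizationPlan_mem hm b)
    fun _ hp => exists_realizationPlan_eq hp

/-- The sequence-form constraints are jointly convex in the initial weights and the plan. -/
theorem realizationPlans_combo {u : ℕ} {m m' : AOHist A Z u → ℝ}
    {p p' : (k : ℕ) → AOHist A Z (u + k) → A → ℝ} (hp : p ∈ realizationPlans m)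
    (hp' : p' ∈ realizationPlans m') {c d : ℝ} (hc : 0 ≤ c) (hd : 0 ≤ d) :
    c • p + d • p' ∈ realizationPlans (c • m + d • m') := by
  refine ⟨fun k θ a => ?_, fun θ => ?_, fun k θ => ?_⟩
  · exact add_nonneg (mul_nonneg hc (hp.1 k θ a)) (mul_nonneg hd (hp'.1 k θ a))
  · simp [Finset.sum_add_distrib, ← Finset.mul_sum, hp.2.1, hp'.2.1]
  · simp [Finset.sum_add_distrib, ← Finset.mul_sum, hp.2.2, hp'.2.2]

theorem convex_realizationPlans {u : ℕ} (m : AOHist A Z u → ℝ) :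
    Convex ℝ (realizationPlans m) := by
  intro p hp p' hp' c d hc hd h
  have := realizationPlans_combo hp hp' hc hd
  rwa [← add_smul, h, one_smul] at this

theorem continuous_realizationPlan {X : Type*} [TopologicalSpace X] {u : ℕ}
    {m : X → AOHist A Z u → ℝ} (hm : Continuous m) {b : X → Strategy A Z} (hb : Continuous b) :
    Continuous fun x => realizationPlan (m x) (b x).1 := by
  refine continuous_pi fun k => ?_
  induction k with
  | zero =>
    simp only [realizationPlan]
    fun_prop
  | succ k ih =>
    simp only [realizationPlan]
    refine continuous_pi fun θ => continuous_pi fun a => Continuous.mul ?_ (by fun_prop)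
    exact (continuous_apply_apply _ _).comp ih

/-- The set is a continuous image of the strategy space, itself compact by Tychonoff. -/
theorem isCompact_realizationPlans [Nonempty A] {u : ℕ} {m : AOHist A Z u → ℝ}
    (hm : ∀ θ, 0 ≤ m θ) : IsCompact (realizationPlans m) := by
  rw [← range_realizationPlan hm]
  exact isCompact_range (continuous_realizationPlan continuous_const continuous_id)

/-- The weights of the private histories at time `t + 1` under a decision rule at time `t`. -/
def ruleWeight {t : ℕ} (β : AOHist A Z t → A → ℝ) (θ : AOHist A Z (t + 1)) : ℝ :=
  β (Fin.init θ) (θ (Fin.last t)).1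

theorem ruleWeight_nonneg {t : ℕ} {β : AOHist A Z t → A → ℝ} (hβ : β ∈ decisionRules A Z t)
    (θ : AOHist A Z (t + 1)) : 0 ≤ ruleWeight β θ :=
  (hβ _).1 _

theorem continuous_ruleWeight {t : ℕ} :
    Continuous (ruleWeight (A := A) (Z := Z) (t := t)) := by
  unfold ruleWeight
  fun_prop

end Strategies

namespace ZsPOSG

variable {S A₁ A₂ Z₁ Z₂ : Type*} [Fintype S] [Fintype A₁] [Fintype A₂] [Fintype Z₁] [Fintype Z₂]

/-! ### The sequence form of the subgames -/

/-- The contribution of chance to the law of (joint history, state) from time `u` on. -/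
def chanceLaw (G : ZsPOSG S A₁ A₂ Z₁ Z₂) {u : ℕ}
    (L : AOHist A₁ Z₁ u → AOHist A₂ Z₂ u → S → ℝ) :
    (k : ℕ) → AOHist A₁ Z₁ (u + k) → AOHist A₂ Z₂ (u + k) → S → ℝ
  | 0 => L
  | k + 1 => fun θ₁ θ₂ s' =>
      ∑ s, chanceLaw G L k (Fin.init θ₁) (Fin.init θ₂) s
        * G.P s (θ₁ (Fin.last (u + k))).1 (θ₂ (Fin.last (u + k))).1 s'
            (θ₁ (Fin.last (u + k))).2 (θ₂ (Fin.last (u + k))).2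

/-- The bilinear payoff of a pair of realization plans. -/
def planPayoff (G : ZsPOSG S A₁ A₂ Z₁ Z₂) {u : ℕ}
    (L : AOHist A₁ Z₁ u → AOHist A₂ Z₂ u → S → ℝ)
    (p₁ : (k : ℕ) → AOHist A₁ Z₁ (u + k) → A₁ → ℝ)
    (p₂ : (k : ℕ) → AOHist A₂ Z₂ (u + k) → A₂ → ℝ) : ℝ :=
  ∑ k ∈ Finset.range (G.H - u), G.γ ^ k *
    ∑ s, ∑ θ₁, ∑ θ₂, ∑ a₁, ∑ a₂,
      p₁ k θ₁ a₁ * p₂ k θ₂ a₂ * G.chanceLaw L k θ₁ θ₂ s * G.r s a₁ a₂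

theorem planPayoff_combo_left (G : ZsPOSG S A₁ A₂ Z₁ Z₂) {u : ℕ}
    (L : AOHist A₁ Z₁ u → AOHist A₂ Z₂ u → S → ℝ)
    (p p' : (k : ℕ) → AOHist A₁ Z₁ (u + k) → A₁ → ℝ)
    (q : (k : ℕ) → AOHist A₂ Z₂ (u + k) → A₂ → ℝ) (c d : ℝ) :
    G.planPayoff L (c • p + d • p') q = c * G.planPayoff L p q + d * G.planPayoff L p' q := by
  simp only [planPayoff, Finset.mul_sum, ← Finset.sum_add_distrib, Pi.add_apply, Pi.smul_apply,
    smul_eq_mul]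
  refine Finset.sum_congr rfl fun k _ => Finset.sum_congr rfl fun s _ =>
    Finset.sum_congr rfl fun θ₁ _ => Finset.sum_congr rfl fun θ₂ _ =>
    Finset.sum_congr rfl fun a₁ _ => Finset.sum_congr rfl fun a₂ _ => ?_
  ring

theorem planPayoff_combo_right (G : ZsPOSG S A₁ A₂ Z₁ Z₂) {u : ℕ}
    (L : AOHist A₁ Z₁ u → AOHist A₂ Z₂ u → S → ℝ)
    (p : (k : ℕ) → AOHist A₁ Z₁ (u + k) → A₁ → ℝ)
    (q q' : (k : ℕ) → AOHist A₂ Z₂ (u + k) → A₂ → ℝ) (c d : ℝ) :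
    G.planPayoff L p (c • q + d • q') = c * G.planPayoff L p q + d * G.planPayoff L p q' := by
  simp only [planPayoff, Finset.mul_sum, ← Finset.sum_add_distrib, Pi.add_apply, Pi.smul_apply,
    smul_eq_mul]
  refine Finset.sum_congr rfl fun k _ => Finset.sum_congr rfl fun s _ =>
    Finset.sum_congr rfl fun θ₁ _ => Finset.sum_congr rfl fun θ₂ _ =>
    Finset.sum_congr rfl fun a₁ _ => Finset.sum_congr rfl fun a₂ _ => ?_
  ring

theorem continuous_planPayoff (G : ZsPOSG S A₁ A₂ Z₁ Z₂) {u : ℕ} {X : Type*} [TopologicalSpace X]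
    (L : AOHist A₁ Z₁ u → AOHist A₂ Z₂ u → S → ℝ)
    {p : X → (k : ℕ) → AOHist A₁ Z₁ (u + k) → A₁ → ℝ}
    {q : X → (k : ℕ) → AOHist A₂ Z₂ (u + k) → A₂ → ℝ} (hp : Continuous p) (hq : Continuous q) :
    Continuous fun x => G.planPayoff L (p x) (q x) := by
  unfold planPayoff
  fun_prop

/-- The law in a subgame is the product of both players' realization weights and of the
contribution of chance. -/
theorem subgameLaw_mul_mul (G : ZsPOSG S A₁ A₂ Z₁ Z₂) {u : ℕ}
    {σ : AOHist A₁ Z₁ u → AOHist A₂ Z₂ u → ℝ} {m₁ : AOHist A₁ Z₁ u → ℝ} {m₂ : AOHist A₂ Z₂ u → ℝ}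
    {L : AOHist A₁ Z₁ u → AOHist A₂ Z₂ u → S → ℝ}
    (hL : ∀ θ₁ θ₂ s, σ θ₁ θ₂ * G.belief u θ₁ θ₂ s = m₁ θ₁ * m₂ θ₂ * L θ₁ θ₂ s)
    (b₁ : Strategy A₁ Z₁) (b₂ : Strategy A₂ Z₂) (k : ℕ) (θ₁ : AOHist A₁ Z₁ (u + k))
    (θ₂ : AOHist A₂ Z₂ (u + k)) (s : S) (a₁ : A₁) (a₂ : A₂) :
    G.subgameLaw u σ b₁ b₂ k θ₁ θ₂ s * b₁.1 (u + k) θ₁ a₁ * b₂.1 (u + k) θ₂ a₂ =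
      realizationPlan m₁ b₁.1 k θ₁ a₁ * realizationPlan m₂ b₂.1 k θ₂ a₂ *
        G.chanceLaw L k θ₁ θ₂ s := by
  -- The actions must vary: the step law at `k + 1` calls on the hypothesis at the last actions
  -- recorded in `θ₁` and `θ₂`.
  induction k generalizing s a₁ a₂ with
  | zero =>
    simp only [subgameLaw, realizationPlan, chanceLaw]
    rw [hL]
    simp only [Nat.add_zero]
    ring
  | succ k ih =>
    change _ * b₁.1 (u + k + 1) θ₁ a₁ * b₂.1 (u + k + 1) θ₂ a₂ = _
    simp only [subgameLaw, realizationPlan, chanceLaw, step, Nat.add_eq]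
    simp only [ih, Finset.mul_sum, Finset.sum_mul]
    refine Finset.sum_congr rfl fun s' _ => ?_
    ring

theorem V_eq_planPayoff (G : ZsPOSG S A₁ A₂ Z₁ Z₂) {u : ℕ}
    {σ : AOHist A₁ Z₁ u → AOHist A₂ Z₂ u → ℝ} {m₁ : AOHist A₁ Z₁ u → ℝ} {m₂ : AOHist A₂ Z₂ u → ℝ}
    {L : AOHist A₁ Z₁ u → AOHist A₂ Z₂ u → S → ℝ}
    (hL : ∀ θ₁ θ₂ s, σ θ₁ θ₂ * G.belief u θ₁ θ₂ s = m₁ θ₁ * m₂ θ₂ * L θ₁ θ₂ s)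
    (b₁ : Strategy A₁ Z₁) (b₂ : Strategy A₂ Z₂) :
    G.V u σ b₁ b₂ = G.planPayoff L (realizationPlan m₁ b₁.1) (realizationPlan m₂ b₂.1) := by
  simp only [V, planPayoff, G.subgameLaw_mul_mul hL]

/-- The weights of (joint history, state) at time `t + 1` without the players' contribution at
time `t`. -/
noncomputable def chanceWeight (G : ZsPOSG S A₁ A₂ Z₁ Z₂) {t : ℕ}
    (σ : AOHist A₁ Z₁ t → AOHist A₂ Z₂ t → ℝ)
    (θ₁ : AOHist A₁ Z₁ (t + 1)) (θ₂ : AOHist A₂ Z₂ (t + 1)) (s : S) : ℝ :=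
  σ (Fin.init θ₁) (Fin.init θ₂)
    * (∑ s, ∑ s', G.P s (θ₁ (Fin.last t)).1 (θ₂ (Fin.last t)).1 s'
          (θ₁ (Fin.last t)).2 (θ₂ (Fin.last t)).2
        * G.belief t (Fin.init θ₁) (Fin.init θ₂) s)
    * G.belief (t + 1) θ₁ θ₂ s

/-- Each current rule becomes the initial weight of its player's plan, so `chanceWeight σ` is free
of both rules. The factorization is pure algebra and asks nothing of the belief, junk values
included. -/
theorem V_T_eq_planPayoff (G : ZsPOSG S A₁ A₂ Z₁ Z₂) {t : ℕ}
    (σ : AOHist A₁ Z₁ t → AOHist A₂ Z₂ t → ℝ)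
    (β₁ : AOHist A₁ Z₁ t → A₁ → ℝ) (β₂ : AOHist A₂ Z₂ t → A₂ → ℝ)
    (b₁ : Strategy A₁ Z₁) (b₂ : Strategy A₂ Z₂) :
    G.V (t + 1) (G.T σ β₁ β₂) b₁ b₂ = G.planPayoff (G.chanceWeight σ)
      (realizationPlan (ruleWeight β₁) b₁.1) (realizationPlan (ruleWeight β₂) b₂.1) :=
  G.V_eq_planPayoff (fun θ₁ θ₂ s => by simp only [T, ruleWeight, chanceWeight]; ring) b₁ b₂

/-! ### The optimal value after one step -/

/-- `V*` at the next occupancy state is the value of a saddle point in realization plans. -/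
theorem exists_saddlePoint_Vstar_T [Nonempty A₁] [Nonempty A₂] (G : ZsPOSG S A₁ A₂ Z₁ Z₂) {t : ℕ}
    (σ : AOHist A₁ Z₁ t → AOHist A₂ Z₂ t → ℝ)
    {β₁ : AOHist A₁ Z₁ t → A₁ → ℝ} {β₂ : AOHist A₂ Z₂ t → A₂ → ℝ}
    (hβ₁ : β₁ ∈ decisionRules A₁ Z₁ t) (hβ₂ : β₂ ∈ decisionRules A₂ Z₂ t) :
    (∃ p ∈ realizationPlans (ruleWeight β₁), ∀ q ∈ realizationPlans (ruleWeight β₂),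
      G.Vstar (t + 1) (G.T σ β₁ β₂) ≤ G.planPayoff (G.chanceWeight σ) p q) ∧
    (∃ q ∈ realizationPlans (ruleWeight β₂), ∀ p ∈ realizationPlans (ruleWeight β₁),
      G.planPayoff (G.chanceWeight σ) p q ≤ G.Vstar (t + 1) (G.T σ β₁ β₂)) := by
  have h₁ := ruleWeight_nonneg hβ₁
  have h₂ := ruleWeight_nonneg hβ₂
  obtain ⟨p, hp, q, hq, hpq⟩ := exists_saddlePoint_of_concave_convex
    (isCompact_realizationPlans h₁) ⟨_, realizationPlan_mem h₁ (Classical.arbitrary _)⟩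
    (convex_realizationPlans _)
    (isCompact_realizationPlans h₂) ⟨_, realizationPlan_mem h₂ (Classical.arbitrary _)⟩
    (convex_realizationPlans _)
    (G.continuous_planPayoff (G.chanceWeight σ) continuous_fst continuous_snd)
    (fun q _ => ⟨convex_realizationPlans _, fun p _ p' _ c d _ _ _ =>
      (G.planPayoff_combo_left _ p p' q c d).ge⟩)
    (fun p _ => ⟨convex_realizationPlans _, fun q _ q' _ c d _ _ _ =>
      (G.planPayoff_combo_right _ p q q' c d).le⟩)
  suffices hv : G.Vstar (t + 1) (G.T σ β₁ β₂) = G.planPayoff (G.chanceWeight σ) p q by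
    rw [hv]
    exact ⟨⟨p, hp, hpq p hp⟩, ⟨q, hq, fun p' hp' => hpq p' hp' q hq⟩⟩
  -- Saddle plans are realized by strategies, which turns the saddle point into a sup-inf over
  -- strategies.
  obtain ⟨b₁, rfl⟩ := exists_realizationPlan_eq hp
  obtain ⟨b₂, rfl⟩ := exists_realizationPlan_eq hq
  simp only [Vstar, V_T_eq_planPayoff]
  -- Real-valued `⨅` and `⨆` are meaningful only with bounds: compactness bounds the infima from
  -- below, and `hle` then bounds the supremum.
  have hbdd : ∀ b₁ : Strategy A₁ Z₁, BddBelow (range fun b₂ : Strategy A₂ Z₂ =>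
      G.planPayoff (G.chanceWeight σ) (realizationPlan (ruleWeight β₁) b₁.1)
        (realizationPlan (ruleWeight β₂) b₂.1)) := fun b₁ =>
    (isCompact_range (G.continuous_planPayoff _ continuous_const
      (continuous_realizationPlan continuous_const continuous_id))).bddBelow
  have hle : ∀ b : Strategy A₁ Z₁, (⨅ b₂ : Strategy A₂ Z₂,
      G.planPayoff (G.chanceWeight σ) (realizationPlan (ruleWeight β₁) b.1)
        (realizationPlan (ruleWeight β₂) b₂.1)) ≤
      G.planPayoff (G.chanceWeight σ) (realizationPlan (ruleWeight β₁) b₁.1)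
        (realizationPlan (ruleWeight β₂) b₂.1) := fun b =>
    (ciInf_le (hbdd b) b₂).trans (hpq _ (realizationPlan_mem h₁ b) _ hq)
  refine le_antisymm (ciSup_le hle) ?_
  exact (le_ciInf fun b => hpq _ hp _ (realizationPlan_mem h₂ b)).trans
    (le_ciSup (f := fun b₁ : Strategy A₁ Z₁ => ⨅ b₂ : Strategy A₂ Z₂,
      G.planPayoff (G.chanceWeight σ) (realizationPlan (ruleWeight β₁) b₁.1)
        (realizationPlan (ruleWeight β₂) b₂.1)) ⟨_, by rintro _ ⟨b, rfl⟩; exact hle b⟩ b₁)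

/-- The mixture of the plans optimal at `β` and `β'` is feasible at the mixed rule. Testing it
against Player 2's optimal plan there compares the three values, since Player 2's feasible set
depends on `β₂` alone. -/
theorem concaveOn_Vstar_T [Nonempty A₁] [Nonempty A₂] (G : ZsPOSG S A₁ A₂ Z₁ Z₂) {t : ℕ}
    (σ : AOHist A₁ Z₁ t → AOHist A₂ Z₂ t → ℝ)
    {β₂ : AOHist A₂ Z₂ t → A₂ → ℝ} (hβ₂ : β₂ ∈ decisionRules A₂ Z₂ t) :
    ConcaveOn ℝ (decisionRules A₁ Z₁ t) fun β₁ => G.Vstar (t + 1) (G.T σ β₁ β₂) := by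
  refine ⟨convex_decisionRules t, fun β hβ β' hβ' c d hc hd hcd => ?_⟩
  obtain ⟨p, hp, hpv⟩ := (G.exists_saddlePoint_Vstar_T σ hβ hβ₂).1
  obtain ⟨p', hp', hpv'⟩ := (G.exists_saddlePoint_Vstar_T σ hβ' hβ₂).1
  obtain ⟨q, hq, hqv⟩ := (G.exists_saddlePoint_Vstar_T σ
    (convex_decisionRules t hβ hβ' hc hd hcd) hβ₂).2
  -- `ruleWeight` is linear, and definitionally so, hence the mixed plan has the required initial
  -- weights.
  refine le_trans ?_ (hqv (c • p + d • p') (realizationPlans_combo hp hp' hc hd))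
  rw [planPayoff_combo_left]
  exact add_le_add (mul_le_mul_of_nonneg_left (hpv q hq) hc)
    (mul_le_mul_of_nonneg_left (hpv' q hq) hd)

theorem convexOn_Vstar_T [Nonempty A₁] [Nonempty A₂] (G : ZsPOSG S A₁ A₂ Z₁ Z₂) {t : ℕ}
    (σ : AOHist A₁ Z₁ t → AOHist A₂ Z₂ t → ℝ)
    {β₁ : AOHist A₁ Z₁ t → A₁ → ℝ} (hβ₁ : β₁ ∈ decisionRules A₁ Z₁ t) :
    ConvexOn ℝ (decisionRules A₂ Z₂ t) fun β₂ => G.Vstar (t + 1) (G.T σ β₁ β₂) := by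
  refine ⟨convex_decisionRules t, fun β hβ β' hβ' c d hc hd hcd => ?_⟩
  obtain ⟨q, hq, hqv⟩ := (G.exists_saddlePoint_Vstar_T σ hβ₁ hβ).2
  obtain ⟨q', hq', hqv'⟩ := (G.exists_saddlePoint_Vstar_T σ hβ₁ hβ').2
  obtain ⟨p, hp, hpv⟩ := (G.exists_saddlePoint_Vstar_T σ hβ₁
    (convex_decisionRules t hβ hβ' hc hd hcd)).1
  refine (hpv (c • q + d • q') (realizationPlans_combo hq hq' hc hd)).trans ?_
  rw [planPayoff_combo_right]
  exact add_le_add (mul_le_mul_of_nonneg_left (hqv p hp) hc)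
    (mul_le_mul_of_nonneg_left (hqv' p hp) hd)

/-- Strategies are used here instead of plans: the sets of plans move with the rules, whereas the
sup and inf over strategies run over fixed compact spaces. -/
theorem continuous_Vstar_T (G : ZsPOSG S A₁ A₂ Z₁ Z₂) {t : ℕ}
    (σ : AOHist A₁ Z₁ t → AOHist A₂ Z₂ t → ℝ) :
    Continuous fun β : (AOHist A₁ Z₁ t → A₁ → ℝ) × (AOHist A₂ Z₂ t → A₂ → ℝ) =>
      G.Vstar (t + 1) (G.T σ β.1 β.2) := by
  have hV : Continuous fun x : (((AOHist A₁ Z₁ t → A₁ → ℝ) × (AOHist A₂ Z₂ t → A₂ → ℝ)) ×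
      Strategy A₁ Z₁) × Strategy A₂ Z₂ => G.V (t + 1) (G.T σ x.1.1.1 x.1.1.2) x.1.2 x.2 := by
    simp only [V_T_eq_planPayoff]
    have h₁ := continuous_realizationPlan (X := (((AOHist A₁ Z₁ t → A₁ → ℝ) ×
      (AOHist A₂ Z₂ t → A₂ → ℝ)) × Strategy A₁ Z₁) × Strategy A₂ Z₂)
      (continuous_ruleWeight.comp continuous_fst.fst.fst) continuous_fst.snd
    have h₂ := continuous_realizationPlan (X := (((AOHist A₁ Z₁ t → A₁ → ℝ) ×
      (AOHist A₂ Z₂ t → A₂ → ℝ)) × Strategy A₁ Z₁) × Strategy A₂ Z₂)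
      (continuous_ruleWeight.comp continuous_fst.fst.snd) continuous_snd
    exact G.continuous_planPayoff (G.chanceWeight σ) h₁ h₂
  have hI : Continuous fun x : ((AOHist A₁ Z₁ t → A₁ → ℝ) × (AOHist A₂ Z₂ t → A₂ → ℝ)) ×
      Strategy A₁ Z₁ => ⨅ b₂ : Strategy A₂ Z₂, G.V (t + 1) (G.T σ x.1.1 x.1.2) x.2 b₂ :=
    continuous_iInf_of_compactSpace hV
  exact continuous_iSup_of_compactSpace (f := fun (β : (AOHist A₁ Z₁ t → A₁ → ℝ) ×
    (AOHist A₂ Z₂ t → A₂ → ℝ)) (b₁ : Strategy A₁ Z₁) =>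
      ⨅ b₂ : Strategy A₂ Z₂, G.V (t + 1) (G.T σ β.1 β.2) b₁ b₂) hI

/-! ### The local game -/

theorem reward_combo_left (G : ZsPOSG S A₁ A₂ Z₁ Z₂) {t : ℕ}
    (σ : AOHist A₁ Z₁ t → AOHist A₂ Z₂ t → ℝ) (β β' : AOHist A₁ Z₁ t → A₁ → ℝ)
    (β₂ : AOHist A₂ Z₂ t → A₂ → ℝ) (c d : ℝ) :
    G.reward σ (c • β + d • β') β₂ = c * G.reward σ β β₂ + d * G.reward σ β' β₂ := by
  simp only [reward, Finset.mul_sum, ← Finset.sum_add_distrib, Pi.add_apply, Pi.smul_apply,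
    smul_eq_mul]
  refine Finset.sum_congr rfl fun s _ =>
    Finset.sum_congr rfl fun θ₁ _ => Finset.sum_congr rfl fun θ₂ _ =>
    Finset.sum_congr rfl fun a₁ _ => Finset.sum_congr rfl fun a₂ _ => ?_
  ring

theorem reward_combo_right (G : ZsPOSG S A₁ A₂ Z₁ Z₂) {t : ℕ}
    (σ : AOHist A₁ Z₁ t → AOHist A₂ Z₂ t → ℝ) (β₁ : AOHist A₁ Z₁ t → A₁ → ℝ)
    (β β' : AOHist A₂ Z₂ t → A₂ → ℝ) (c d : ℝ) :
    G.reward σ β₁ (c • β + d • β') = c * G.reward σ β₁ β + d * G.reward σ β₁ β' := by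
  simp only [reward, Finset.mul_sum, ← Finset.sum_add_distrib, Pi.add_apply, Pi.smul_apply,
    smul_eq_mul]
  refine Finset.sum_congr rfl fun s _ =>
    Finset.sum_congr rfl fun θ₁ _ => Finset.sum_congr rfl fun θ₂ _ =>
    Finset.sum_congr rfl fun a₁ _ => Finset.sum_congr rfl fun a₂ _ => ?_
  ring

theorem concaveOn_Qstar [Nonempty A₁] [Nonempty A₂] (G : ZsPOSG S A₁ A₂ Z₁ Z₂) (τ : ℕ)
    (σ : AOHist A₁ Z₁ τ → AOHist A₂ Z₂ τ → ℝ)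
    {β₂ : AOHist A₂ Z₂ τ → A₂ → ℝ} (hβ₂ : β₂ ∈ decisionRules A₂ Z₂ τ) :
    ConcaveOn ℝ (decisionRules A₁ Z₁ τ) fun β₁ => G.Qstar τ σ β₁ β₂ :=
  ConcaveOn.add ⟨convex_decisionRules τ, fun β _ β' _ c d _ _ _ =>
    (G.reward_combo_left σ β β' β₂ c d).ge⟩ ((G.concaveOn_Vstar_T σ hβ₂).smul G.γ_nonneg)

theorem convexOn_Qstar [Nonempty A₁] [Nonempty A₂] (G : ZsPOSG S A₁ A₂ Z₁ Z₂) (τ : ℕ)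
    (σ : AOHist A₁ Z₁ τ → AOHist A₂ Z₂ τ → ℝ)
    {β₁ : AOHist A₁ Z₁ τ → A₁ → ℝ} (hβ₁ : β₁ ∈ decisionRules A₁ Z₁ τ) :
    ConvexOn ℝ (decisionRules A₂ Z₂ τ) fun β₂ => G.Qstar τ σ β₁ β₂ :=
  ConvexOn.add ⟨convex_decisionRules τ, fun β _ β' _ c d _ _ _ =>
    (G.reward_combo_right σ β₁ β β' c d).le⟩ ((G.convexOn_Vstar_T σ hβ₁).smul G.γ_nonneg)

theorem continuous_Qstar (G : ZsPOSG S A₁ A₂ Z₁ Z₂) (τ : ℕ)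
    (σ : AOHist A₁ Z₁ τ → AOHist A₂ Z₂ τ → ℝ) :
    Continuous fun β : (AOHist A₁ Z₁ τ → A₁ → ℝ) × (AOHist A₂ Z₂ τ → A₂ → ℝ) =>
      G.Qstar τ σ β.1 β.2 := by
  refine Continuous.add ?_ (continuous_const.mul (G.continuous_Vstar_T σ))
  unfold reward
  fun_prop

end ZsPOSG

theorem mainTheorem3 {S A₁ A₂ Z₁ Z₂ : Type*}
    [Fintype S] [Fintype A₁] [Fintype A₂] [Fintype Z₁] [Fintype Z₂]
    [Nonempty A₁] [Nonempty A₂]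
    (G : ZsPOSG S A₁ A₂ Z₁ Z₂) (τ : ℕ) (hτ : τ < G.H)
    (σ : AOHist A₁ Z₁ τ → AOHist A₂ Z₂ τ → ℝ) (hσ : σ ∈ G.occupancyStates τ) :
    -- concavity in the decision rule of Player 1, convexity in the one of Player 2
    (∀ β₂ ∈ decisionRules A₂ Z₂ τ,
      ConcaveOn ℝ (decisionRules A₁ Z₁ τ) (fun β₁ => G.Qstar τ σ β₁ β₂)) ∧
    (∀ β₁ ∈ decisionRules A₁ Z₁ τ,
      ConvexOn ℝ (decisionRules A₂ Z₂ τ) (fun β₂ => G.Qstar τ σ β₁ β₂)) ∧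
    -- the minimax theorem for the local game: the minima and maxima that define `W^{1,*}` and
    -- `W^{2,*}` are attained, and `max W^{1,*} = min W^{2,*}`, both attained
    (∀ β₁ ∈ decisionRules A₁ Z₁ τ,
      IsLeast ((fun β₂ => G.Qstar τ σ β₁ β₂) '' decisionRules A₂ Z₂ τ) (G.W₁star τ σ β₁)) ∧
    (∀ β₂ ∈ decisionRules A₂ Z₂ τ,
      IsGreatest ((fun β₁ => G.Qstar τ σ β₁ β₂) '' decisionRules A₁ Z₁ τ) (G.W₂star τ σ β₂)) ∧
    (∃ v : ℝ,
      IsGreatest (G.W₁star τ σ '' decisionRules A₁ Z₁ τ) v ∧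
      IsLeast (G.W₂star τ σ '' decisionRules A₂ Z₂ τ) v) := by
  obtain ⟨hl, hg, hv⟩ := minimax_attained (isCompact_decisionRules τ) (decisionRules_nonempty τ)
    (convex_decisionRules τ) (isCompact_decisionRules τ) (decisionRules_nonempty τ)
    (convex_decisionRules τ) (G.continuous_Qstar τ σ)
    (fun _ h => G.concaveOn_Qstar τ σ h) (fun _ h => G.convexOn_Qstar τ σ h)
  exact ⟨fun _ h => G.concaveOn_Qstar τ σ h, fun _ h => G.convexOn_Qstar τ σ h,
    fun β₁ _ => hl β₁, fun β₂ _ => hg β₂, hv⟩
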